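/- Let $N\ge1$ and let $J:\mathbb R^N\to[0,\infty)$ be a Lévy kernel, i.e. $J$ is nonnegative, radially symmetric, positive near the origin and $\int_{\mathbb R^N}J(z)\,(|z|^2\wedge1)\,dz<\infty$. Put $$m(\xi)=\int_{\mathbb R^N}\bigl(1-\cos(z\cdot\xi)\bigr)J(z)\,dz,\qquad \mathcal E(f,f)=\frac12\int_{\mathbb R^N}\int_{\mathbb R^N}(f(x)-f(y))^2J(x-y)\,dx\,dy .$$ Let $0<\gamma\le2$ and $1<r<s\le2$, and set $$\theta_1=\frac{r[N(2-s)+\gamma s]}{s[N(2-r)+\gamma r]},\qquad \theta_2=\frac{r(2-s)}{s(2-r)} .$$ Suppose that for some $\kappa>0$ the multiplier satisfies $m(\xi)\ge\kappa|\xi|^\gamma$ for all $|\xi|\le1$. Then $\mu:=\inf_{|\xi|\ge1}m(\xi)>0$, and there is a constant $c>0$, depending only on $N,\gamma,r,s,\kappa$ and $\mu$, such that for every real-valued $z\in L^2(\mathbb R^N)\cap L^r(\mathbb R^N)$ with $\mathcal E(z,z)<\infty$, $$\mathcal E(z,z)\ \ge\ c\,\min\left\{\left(\|z\|_s\|z\|_r^{-\theta_1}\right)^{\frac{2}{1-\theta_1}},\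 \left(\|z\|_s\|z\|_r^{-\theta_2}\right)^{\frac{2}{1-\theta_2}}\right\},$$ where the right-hand side is read as $0$ if $z=0$ almost everywhere. -/

import Mathlib

open MeasureTheory
open scoped ENNReal

noncomputable section

/-- Lévy kernels on `ℝ^N`: nonnegative, radially symmetric, positive near the origin, and such that
`∫ J(z) (|z|² ∧ 1) dz < ∞`. Positivity is asked only off the origin, where a singular kernel
such as `|z|^(-N-α)` has no value. Integrability contains the (a.e.) measurability of `J`. -/
structure IsLevyKernel {N : ℕ} (J : EuclideanSpace ℝ (Fin N) → ℝ) : Prop where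
  nonneg : ∀ z, 0 ≤ J z
  radial : ∀ x y, ‖x‖ = ‖y‖ → J x = J y
  pos_near_zero : ∃ δ > 0, ∀ z, z ≠ 0 → ‖z‖ < δ → 0 < J z
  integrable : Integrable (fun z => J z * min (‖z‖ ^ 2) 1) volume

/-- The multiplier (symbol) `m(ξ) = ∫ (1 - cos (z · ξ)) J(z) dz` of the operator with kernel `J`. -/
def multiplier {N : ℕ} (J : EuclideanSpace ℝ (Fin N) → ℝ) (ξ : EuclideanSpace ℝ (Fin N)) : ℝ :=
  ∫ z, (1 - Real.cos (inner ℝ z ξ)) * J z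

/-- The infimum of the multiplier over `|ξ| ≥ 1`. -/
def multiplierInf {N : ℕ} (J : EuclideanSpace ℝ (Fin N) → ℝ) : ℝ :=
  ⨅ ξ : {ξ : EuclideanSpace ℝ (Fin N) // 1 ≤ ‖ξ‖}, multiplier J ξ

/-- The Dirichlet form `E(f,f) = ½ ∬ (f(x) - f(y))² J(x - y) dx dy`, with values in `[0,∞]`. -/
def dirichletForm {N : ℕ} (J f : EuclideanSpace ℝ (Fin N) → ℝ) : ℝ≥0∞ :=
  2⁻¹ * ∫⁻ x, ∫⁻ y, ENNReal.ofReal ((f x - f y) ^ 2 * J (x - y))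

/-- Membership in the energy space `H_L(ℝ^N) = {f ∈ L² : E(f,f) < ∞}`. -/
def MemEnergySpace {N : ℕ} (J f : EuclideanSpace ℝ (Fin N) → ℝ) : Prop :=
  MemLp f 2 volume ∧ dirichletForm J f < ∞

/-- The norm `‖f‖_p` of `L^p(ℝ^N)` for a real exponent `p`, as a real number. -/
def realLpNorm {N : ℕ} (p : ℝ) (f : EuclideanSpace ℝ (Fin N) → ℝ) : ℝ :=
  (eLpNorm f (ENNReal.ofReal p) volume).toReal

/-- `θ₁ = r [N (2 - s) + γ s] / (s [N (2 - r) + γ r])`. -/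
def theta₁ (N : ℕ) (γ r s : ℝ) : ℝ :=
  (r * ((N : ℝ) * (2 - s) + γ * s)) / (s * ((N : ℝ) * (2 - r) + γ * r))

/-- `θ₂ = r (2 - s) / (s (2 - r))`. -/
def theta₂ (r s : ℝ) : ℝ :=
  (r * (2 - s)) / (s * (2 - r))

end

/-!
The proof is Nash's, with averages over balls of radius `ε ≥ 1`. If `k` is the normalised indicator
of such a ball, then `‖f‖₂²` is at most half the energy of `f` for the kernel `k` plus
`∬ |f(x)| |f(y)| k(x - y) dx dy`, and Young's inequality bounds the last integral by a multiple of
`ε ^ (-N (2/r - 1)) ‖f‖_r²`. Plancherel's theorem diagonalises both quadratic forms, and the symbol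
of `k` is at most `2 ε ^ γ min(|ξ| ^ γ, 1)`, whereas that of `J` is at least
`min(κ, μ) min(|ξ| ^ γ, 1)`. Here `μ > 0` because the symbol of an integrable kernel is continuous,
positive off the origin, and tends to the mass of the kernel at infinity. Hence
`‖f‖₂² ≤ K (ε ^ γ E(f,f) + ε ^ (-N (2/r - 1)) ‖f‖_r²)` for all `ε ≥ 1`.

If `E(f,f) ≤ ‖f‖_r²`, the optimal `ε` is admissible and gives the exponent with `θ₁`; otherwise
`ε = 1` gives the exponent with `θ₂`. Interpolating `L^s` between `L^r` and `L²` replaces `‖f‖₂` by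
`‖f‖_s`.
-/

theorem eLpNorm_two_sq_eq_lintegral {α F : Type*} [MeasurableSpace α] [NormedAddCommGroup F]
    {μ : Measure α} (f : α → F) : eLpNorm f 2 μ ^ 2 = ∫⁻ x, ‖f x‖ₑ ^ 2 ∂μ := by
  simpa using eLpNorm_nnreal_pow_eq_lintegral (p := 2) (f := f) (μ := μ) two_ne_zero

section FourierTranslation

open scoped FourierTransform RealInnerProductSpace SchwartzMap

variable {E F : Type*} [NormedAddCommGroup E] [InnerProductSpace ℝ E] [FiniteDimensional ℝ E]
  [MeasurableSpace E] [BorelSpace E]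
  [NormedAddCommGroup F] [InnerProductSpace ℂ F]

theorem schwartzMap_fourier_compSubConstCLM (h : E) (g : 𝓢(E, F)) (ξ : E) :
    𝓕 (g.compSubConstCLM ℂ h) ξ = (𝐞 (-⟪h, ξ⟫) : ℂ) • 𝓕 g ξ := by
  have htranslate : ⇑(g.compSubConstCLM ℂ h) = g ∘ fun v => v + -h := by
    ext v
    rw [SchwartzMap.compSubConstCLM_apply, Function.comp_apply, sub_eq_add_neg]
  rw [SchwartzMap.fourier_coe, SchwartzMap.fourier_coe, htranslate]
  refine (congrFun (VectorFourier.fourierIntegral_comp_add_right 𝐞 volume (innerₗ E) g (-h))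
    ξ).trans ?_
  simp only [map_neg, LinearMap.neg_apply, innerₗ_apply_apply, Circle.smul_def]
  rfl

theorem toLp_schwartzMap_compSubConstCLM (h : E) (g : 𝓢(E, F)) :
    (g.compSubConstCLM ℂ h).toLp 2 =
      Lp.compMeasurePreserving (· - h) (measurePreserving_sub_right volume h) (g.toLp 2) := by
  apply Lp.ext
  filter_upwards [Lp.coeFn_compMeasurePreserving (g.toLp 2)
      (measurePreserving_sub_right volume h), (g.compSubConstCLM ℂ h).coeFn_toLp 2 volume,
    (measurePreserving_sub_right volume h).quasiMeasurePreserving.ae (g.coeFn_toLp 2 volume)]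
    with x hcomp hleft hright
  rw [hleft, hcomp, Function.comp_apply, hright, SchwartzMap.compSubConstCLM_apply]

theorem memLp_top_fourierChar_inner (h : E) :
    MemLp (fun ξ : E => (𝐞 (-⟪h, ξ⟫) : ℂ)) ∞ volume := by
  refine memLp_top_of_bound (Continuous.aestronglyMeasurable ?_) 1
    (Filter.Eventually.of_forall fun ξ => (Circle.norm_coe _).le)
  exact continuous_subtype_val.comp (Real.continuous_fourierChar.comp (by fun_prop))

variable [CompleteSpace F]

theorem fourier_compMeasurePreserving_sub (h : E) (f : Lp F 2 (volume : Measure E)) :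
    (𝓕 (Lp.compMeasurePreserving (· - h) (measurePreserving_sub_right volume h) f) :
      Lp F 2 (volume : Measure E)) =ᵐ[volume] fun ξ => (𝐞 (-⟪h, ξ⟫) : ℂ) • (𝓕 f) ξ := by
  let translate : Lp F 2 (volume : Measure E) →ₗᵢ[ℂ] Lp F 2 (volume : Measure E) :=
    Lp.compMeasurePreservingₗᵢ ℂ (· - h) (measurePreserving_sub_right volume h)
  let modulate : Lp F 2 (volume : Measure E) →L[ℂ] Lp F 2 (volume : Measure E) :=
    (ContinuousLinearMap.lsmul ℂ ℂ).holderL volume ∞ 2 2 (memLp_top_fourierChar_inner h).toLp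
  have hmodulate (g : Lp F 2 (volume : Measure E)) :
      modulate g =ᵐ[volume] fun ξ => (𝐞 (-⟪h, ξ⟫) : ℂ) • g ξ := by
    filter_upwards [(ContinuousLinearMap.lsmul ℂ ℂ).coeFn_holder (r := 2)
      (memLp_top_fourierChar_inner h).toLp g, (memLp_top_fourierChar_inner h).coeFn_toLp]
      with ξ hholder hchar
    exact hholder.trans (by rw [hchar, ContinuousLinearMap.lsmul_apply])
  suffices hcomm : 𝓕 (translate f) = modulate (𝓕 f) by
    exact (congrArg (fun g : Lp F 2 (volume : Measure E) => ⇑g) hcomm).eventuallyEq.trans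
      (hmodulate _)
  refine DenseRange.induction_on (p := fun f => 𝓕 (translate f) = modulate (𝓕 f))
    (SchwartzMap.denseRange_toLpCLM (p := 2) ENNReal.ofNat_ne_top) f ?_ fun g => ?_
  · exact isClosed_eq ((Lp.fourierTransformₗᵢ E F).continuous.comp translate.continuous)
      (modulate.continuous.comp (Lp.fourierTransformₗᵢ E F).continuous)
  · have htranslate : translate (g.toLp 2) = (g.compSubConstCLM ℂ h).toLp 2 :=
      (toLp_schwartzMap_compSubConstCLM h g).symm
    rw [SchwartzMap.toLpCLM_apply, htranslate, SchwartzMap.toLp_fourier_eq,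
      SchwartzMap.toLp_fourier_eq]
    apply Lp.ext
    filter_upwards [hmodulate ((𝓕 g).toLp 2), (𝓕 (g.compSubConstCLM ℂ h)).coeFn_toLp 2 volume,
      (𝓕 g).coeFn_toLp 2 volume] with ξ hright hleft hg
    rw [hright, hleft, hg, schwartzMap_fourier_compSubConstCLM]

theorem enorm_one_sub_fourierChar_sq (t : ℝ) :
    ‖1 - (𝐞 (-t) : ℂ)‖ₑ ^ 2 = ENNReal.ofReal (2 * (1 - Real.cos (2 * Real.pi * t))) := by
  have hchar : (𝐞 (-t) : ℂ) = Complex.exp (Complex.I * (-(2 * Real.pi * t) : ℝ)) := by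
    rw [Real.fourierChar_apply]
    congr 1
    push_cast
    ring
  rw [← ofReal_norm, ← ENNReal.ofReal_pow (norm_nonneg _), hchar, norm_sub_rev,
    Complex.norm_exp_I_mul_ofReal_sub_one, Real.norm_eq_abs, sq_abs, mul_pow,
    Real.sin_sq_eq_half_sub]
  congr 1
  rw [show 2 * (-(2 * Real.pi * t) / 2) = -(2 * Real.pi * t) by ring, Real.cos_neg]
  ring

theorem lintegral_enorm_sub_translate_sq {f : E → F} (hf : MemLp f 2 volume) (h : E) :
    ∫⁻ x, ‖f x - f (x - h)‖ₑ ^ 2 =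
      ∫⁻ ξ, ENNReal.ofReal (2 * (1 - Real.cos (2 * Real.pi * ⟪h, ξ⟫))) *
        ‖(𝓕 (hf.toLp f) : Lp F 2 (volume : Measure E)) ξ‖ₑ ^ 2 := by
  let g : Lp F 2 (volume : Measure E) := hf.toLp f
  let translate : Lp F 2 (volume : Measure E) :=
    Lp.compMeasurePreserving (· - h) (measurePreserving_sub_right volume h) g
  have hspace : g - translate =ᵐ[volume] fun x => f x - f (x - h) := by
    filter_upwards [Lp.coeFn_sub g translate, hf.coeFn_toLp,
      (measurePreserving_sub_right volume h).quasiMeasurePreserving.ae hf.coeFn_toLp,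
      Lp.coeFn_compMeasurePreserving g (measurePreserving_sub_right volume h)]
      with x hsub hg hgh htranslate
    rw [hsub, Pi.sub_apply, htranslate, Function.comp_apply, hg, hgh]
  have hfrequency : (𝓕 (g - translate) : Lp F 2 (volume : Measure E)) =ᵐ[volume]
      fun ξ => (1 - (𝐞 (-⟪h, ξ⟫) : ℂ)) • (𝓕 g : Lp F 2 (volume : Measure E)) ξ := by
    rw [show 𝓕 (g - translate) = 𝓕 g - 𝓕 translate from
      (Lp.fourierTransformₗᵢ E F).map_sub g translate]
    filter_upwards [Lp.coeFn_sub (𝓕 g) (𝓕 translate), fourier_compMeasurePreserving_sub h g]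
      with ξ hsub htranslate
    rw [hsub, Pi.sub_apply, htranslate, sub_smul, one_smul]
  calc ∫⁻ x, ‖f x - f (x - h)‖ₑ ^ 2
      = ∫⁻ x, ‖(g - translate) x‖ₑ ^ 2 :=
        lintegral_congr_ae (hspace.mono fun x hx => by dsimp only; rw [hx])
    _ = ∫⁻ ξ, ‖(𝓕 (g - translate) : Lp F 2 (volume : Measure E)) ξ‖ₑ ^ 2 := by
        rw [← eLpNorm_two_sq_eq_lintegral, ← eLpNorm_two_sq_eq_lintegral, ← Lp.enorm_def,
          ← Lp.enorm_def, ← ofReal_norm, ← ofReal_norm, Lp.norm_fourier_eq]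
    _ = _ := lintegral_congr_ae <| hfrequency.mono fun ξ hξ => by
        dsimp only
        rw [hξ, enorm_smul, mul_pow, enorm_one_sub_fourierChar_sq]

end FourierTranslation

theorem enorm_sq_add_enorm_sq_le {F : Type*} [NormedAddCommGroup F] (a b : F) :
    ‖a‖ₑ ^ 2 + ‖b‖ₑ ^ 2 ≤ ‖a - b‖ₑ ^ 2 + 2 * (‖a‖ₑ * ‖b‖ₑ) := by
  have hreal : ‖a‖ ^ 2 + ‖b‖ ^ 2 ≤ ‖a - b‖ ^ 2 + 2 * (‖a‖ * ‖b‖) := by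
    have hreverse : (‖a‖ - ‖b‖) ^ 2 ≤ ‖a - b‖ ^ 2 :=
      sq_le_sq.2 (by simpa only [abs_norm] using abs_norm_sub_norm_le a b)
    linarith [sub_sq ‖a‖ ‖b‖]
  simp only [enorm_eq_nnnorm]
  exact_mod_cast hreal

section TranslationInvariant

variable {G F : Type*} [AddCommGroup G] [MeasurableSpace G] [NormedAddCommGroup F]

/-- The quadratic form `∬ ‖f x - f y‖² j(x - y) dμ(x) dμ(y)` of a translation invariant kernel,
without the customary factor `1/2`; it is `2 E(f,f)` for the Dirichlet form `E` of `j`. -/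
noncomputable def kernelEnergy (μ : Measure G) (j : G → ℝ≥0∞) (f : G → F) : ℝ≥0∞ :=
  ∫⁻ x, ∫⁻ y, ‖f x - f y‖ₑ ^ 2 * j (x - y) ∂μ ∂μ

variable [MeasurableAdd₂ G] [MeasurableNeg G] {μ : Measure G} [SFinite μ]
  [μ.IsAddLeftInvariant] {j : G → ℝ≥0∞} {f : G → F}

theorem aemeasurable_comp_sub (hj : AEMeasurable j μ) :
    AEMeasurable (fun p : G × G => j (p.1 - p.2)) (μ.prod μ) :=
  hj.comp_quasiMeasurePreserving (quasiMeasurePreserving_sub μ μ)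

theorem lintegral_prod_snd_mul_comp_sub {u : G → ℝ≥0∞} (hu : AEMeasurable u μ)
    (hj : AEMeasurable j μ) :
    ∫⁻ p : G × G, u p.2 * j (p.1 - p.2) ∂μ.prod μ = (∫⁻ x, u x ∂μ) * ∫⁻ x, j x ∂μ := by
  rw [lintegral_prod_symm _ (hu.comp_snd.fun_mul (aemeasurable_comp_sub hj)),
    ← lintegral_mul_const'' _ hu]
  refine lintegral_congr fun y => ?_
  dsimp only
  rw [lintegral_const_mul'', lintegral_sub_right_eq_self j y]
  exact hj.comp_quasiMeasurePreserving
    (measurePreserving_sub_right μ y).quasiMeasurePreserving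

variable [μ.IsNegInvariant]

theorem lintegral_prod_fst_mul_comp_sub {u : G → ℝ≥0∞} (hu : AEMeasurable u μ)
    (hj : AEMeasurable j μ) :
    ∫⁻ p : G × G, u p.1 * j (p.1 - p.2) ∂μ.prod μ = (∫⁻ x, u x ∂μ) * ∫⁻ x, j x ∂μ := by
  rw [lintegral_prod _ (hu.comp_fst.fun_mul (aemeasurable_comp_sub hj)),
    ← lintegral_mul_const'' _ hu]
  refine lintegral_congr fun x => ?_
  dsimp only
  rw [lintegral_const_mul'', lintegral_sub_left_eq_self j x]
  exact hj.comp_quasiMeasurePreserving (quasiMeasurePreserving_sub_left μ x)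

theorem kernelEnergy_eq_lintegral_translate (hj : AEMeasurable j μ)
    (hf : AEStronglyMeasurable f μ) :
    kernelEnergy μ j f = ∫⁻ h, (∫⁻ x, ‖f x - f (x - h)‖ₑ ^ 2 ∂μ) * j h ∂μ := by
  have hsub : AEStronglyMeasurable (fun p : G × G => f (p.1 - p.2)) (μ.prod μ) :=
    hf.comp_quasiMeasurePreserving (quasiMeasurePreserving_sub μ μ)
  calc kernelEnergy μ j f = ∫⁻ x, ∫⁻ h, ‖f x - f (x - h)‖ₑ ^ 2 * j h ∂μ ∂μ := by
        refine lintegral_congr fun x => ?_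
        rw [← lintegral_sub_left_eq_self (fun h => ‖f x - f (x - h)‖ₑ ^ 2 * j h) x]
        simp only [sub_sub_cancel]
    _ = ∫⁻ h, ∫⁻ x, ‖f x - f (x - h)‖ₑ ^ 2 * j h ∂μ ∂μ :=
        lintegral_lintegral_swap
          (((hf.comp_fst.fun_sub hsub).enorm.pow_const 2).fun_mul hj.comp_snd)
    _ = _ := by
        refine lintegral_congr fun h => lintegral_mul_const'' _ ?_
        exact ((hf.sub (hf.comp_quasiMeasurePreserving
          (measurePreserving_sub_right μ h).quasiMeasurePreserving)).enorm.pow_const 2)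

theorem two_mul_lintegral_enorm_sq_le (hj : AEMeasurable j μ) (hj₁ : ∫⁻ x, j x ∂μ = 1)
    (hf : AEStronglyMeasurable f μ) :
    2 * ∫⁻ x, ‖f x‖ₑ ^ 2 ∂μ ≤
      kernelEnergy μ j f + 2 * ∫⁻ x, ∫⁻ y, ‖f x‖ₑ * ‖f y‖ₑ * j (x - y) ∂μ ∂μ := by
  have hj' := aemeasurable_comp_sub hj
  have hsq : AEMeasurable (fun x => ‖f x‖ₑ ^ 2) μ := hf.enorm.pow_const 2
  have henergy : AEMeasurable (fun p : G × G => ‖f p.1 - f p.2‖ₑ ^ 2 * j (p.1 - p.2))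
      (μ.prod μ) := ((hf.comp_fst.sub hf.comp_snd).enorm.pow_const 2).mul hj'
  have hcross : AEMeasurable (fun p : G × G => ‖f p.1‖ₑ * ‖f p.2‖ₑ * j (p.1 - p.2))
      (μ.prod μ) := (hf.enorm.comp_fst.mul hf.enorm.comp_snd).mul hj'
  calc 2 * ∫⁻ x, ‖f x‖ₑ ^ 2 ∂μ
      = ∫⁻ p : G × G, ‖f p.1‖ₑ ^ 2 * j (p.1 - p.2) + ‖f p.2‖ₑ ^ 2 * j (p.1 - p.2)
          ∂μ.prod μ := by
        rw [lintegral_add_left' (hsq.comp_fst.fun_mul hj'), lintegral_prod_fst_mul_comp_sub hsq hj,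
          lintegral_prod_snd_mul_comp_sub hsq hj, hj₁, mul_one, two_mul]
    _ ≤ ∫⁻ p : G × G, ‖f p.1 - f p.2‖ₑ ^ 2 * j (p.1 - p.2) +
          2 * (‖f p.1‖ₑ * ‖f p.2‖ₑ * j (p.1 - p.2)) ∂μ.prod μ := by
        refine lintegral_mono fun p => ?_
        rw [← add_mul, ← mul_assoc, ← add_mul]
        exact mul_le_mul_left (enorm_sq_add_enorm_sq_le _ _) _
    _ = _ := by
        rw [lintegral_add_left' henergy, lintegral_const_mul'' _ hcross, lintegral_prod _ henergy,
          lintegral_prod _ hcross, kernelEnergy]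

end TranslationInvariant

theorem eLpNorm_ofReal_eq_lintegral {α F : Type*} [MeasurableSpace α] [NormedAddCommGroup F]
    {μ : Measure α} {p : ℝ} (hp : 0 < p) (f : α → F) :
    eLpNorm f (ENNReal.ofReal p) μ = (∫⁻ x, ‖f x‖ₑ ^ p ∂μ) ^ (1 / p) := by
  rw [eLpNorm_eq_lintegral_rpow_enorm_toReal (by simpa using hp) ENNReal.ofReal_ne_top,
    ENNReal.toReal_ofReal hp.le]

theorem lintegral_mul_mul_rpow_le {α : Type*} [MeasurableSpace α] {μ : Measure α}
    {u v w : α → ℝ≥0∞} (hu : AEMeasurable u μ) (hv : AEMeasurable v μ) (hw : AEMeasurable w μ)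
    {a b c : ℝ} (ha : 0 ≤ a) (hb : 0 ≤ b) (hc : 0 ≤ c) (habc : a + b + c = 1) :
    ∫⁻ x, u x ^ a * v x ^ b * w x ^ c ∂μ ≤
      (∫⁻ x, u x ∂μ) ^ a * (∫⁻ x, v x ∂μ) ^ b * (∫⁻ x, w x ∂μ) ^ c := by
  have holder := ENNReal.lintegral_prod_norm_pow_le (μ := μ) Finset.univ (f := ![u, v, w])
    (fun i _ => by fin_cases i <;> assumption) (p := ![a, b, c])
    (by simpa [Fin.sum_univ_three] using habc) (fun i _ => by fin_cases i <;> assumption)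
  simpa [Fin.prod_univ_three] using holder

theorem mul_rpow_mul_mul_rpow_mul_mul_rpow (x y m : ℝ≥0∞) {a b c : ℝ} (ha : 0 ≤ a) (hb : 0 ≤ b)
    (hc : 0 ≤ c) :
    (x * y) ^ a * (x * m) ^ b * (y * m) ^ c = x ^ (a + b) * y ^ (a + c) * m ^ (b + c) := by
  simp only [ENNReal.mul_rpow_of_nonneg _ _ ha, ENNReal.mul_rpow_of_nonneg _ _ hb,
    ENNReal.mul_rpow_of_nonneg _ _ hc, ENNReal.rpow_add_of_nonneg _ _ ha hb,
    ENNReal.rpow_add_of_nonneg _ _ ha hc, ENNReal.rpow_add_of_nonneg _ _ hb hc]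
  ring

section Young

variable {G F F' : Type*} [AddCommGroup G] [MeasurableSpace G] [MeasurableAdd₂ G]
  [MeasurableNeg G] {μ : Measure G} [SFinite μ] [μ.IsAddLeftInvariant] [μ.IsNegInvariant]
  [NormedAddCommGroup F] [NormedAddCommGroup F'] {f : G → F} {g : G → F'} {B : Set G} {p q : ℝ}

theorem lintegral_mul_mul_indicator_sub_le (hB : MeasurableSet B) (hf : AEStronglyMeasurable f μ)
    (hg : AEStronglyMeasurable g μ) (hp : 1 ≤ p) (hq : 1 ≤ q) (hpq : 1 ≤ 1 / p + 1 / q) :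
    ∫⁻ x, ∫⁻ y, ‖f x‖ₑ * ‖g y‖ₑ * B.indicator 1 (x - y) ∂μ ∂μ ≤
      eLpNorm f (ENNReal.ofReal p) μ * eLpNorm g (ENNReal.ofReal q) μ *
        μ B ^ (2 - 1 / p - 1 / q) := by
  have hp₀ : 0 < p := one_pos.trans_le hp
  have hq₀ : 0 < q := one_pos.trans_le hq
  have ha : 0 ≤ 1 / p + 1 / q - 1 := sub_nonneg.2 hpq
  have hb : 0 ≤ 1 - 1 / q := sub_nonneg.2 ((div_le_one hq₀).2 hq)
  have hc : 0 ≤ 1 - 1 / p := sub_nonneg.2 ((div_le_one hp₀).2 hp)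
  have hab : 1 / p + 1 / q - 1 + (1 - 1 / q) = 1 / p := by ring
  have hac : 1 / p + 1 / q - 1 + (1 - 1 / p) = 1 / q := by ring
  have hbc : 1 - 1 / q + (1 - 1 / p) = 2 - 1 / p - 1 / q := by ring
  have hk : AEMeasurable (B.indicator 1 : G → ℝ≥0∞) μ := (measurable_one.indicator hB).aemeasurable
  have hk' := aemeasurable_comp_sub hk
  have hfp : AEMeasurable (fun x => ‖f x‖ₑ ^ p) μ := hf.enorm.pow_const p
  have hgq : AEMeasurable (fun x => ‖g x‖ₑ ^ q) μ := hg.enorm.pow_const q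
  rw [← lintegral_prod (fun z : G × G => ‖f z.1‖ₑ * ‖g z.2‖ₑ * B.indicator 1 (z.1 - z.2))
    ((hf.enorm.comp_fst.fun_mul hg.enorm.comp_snd).fun_mul hk')]
  calc ∫⁻ z : G × G, ‖f z.1‖ₑ * ‖g z.2‖ₑ * B.indicator 1 (z.1 - z.2) ∂μ.prod μ
      ≤ ∫⁻ z : G × G, (‖f z.1‖ₑ ^ p * ‖g z.2‖ₑ ^ q) ^ (1 / p + 1 / q - 1) *
          (‖f z.1‖ₑ ^ p * B.indicator 1 (z.1 - z.2)) ^ (1 - 1 / q) *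
          (‖g z.2‖ₑ ^ q * B.indicator 1 (z.1 - z.2)) ^ (1 - 1 / p) ∂μ.prod μ := by
        refine lintegral_mono fun z => ?_
        by_cases hz : z.1 - z.2 ∈ B
        · rw [mul_rpow_mul_mul_rpow_mul_mul_rpow _ _ _ ha hb hc, hab, hac,
            Set.indicator_of_mem hz, Pi.one_apply, ENNReal.one_rpow, one_div, one_div,
            ENNReal.rpow_rpow_inv hp₀.ne', ENNReal.rpow_rpow_inv hq₀.ne']
        · rw [Set.indicator_of_notMem hz, mul_zero]
          exact zero_le
    _ ≤ _ := lintegral_mul_mul_rpow_le (hfp.comp_fst.fun_mul hgq.comp_snd)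
        (hfp.comp_fst.fun_mul hk') (hgq.comp_snd.fun_mul hk') ha hb hc (by ring)
    _ = _ := by
        rw [lintegral_prod_mul hfp hgq, lintegral_prod_fst_mul_comp_sub hfp hk,
          lintegral_prod_snd_mul_comp_sub hgq hk, lintegral_indicator_one hB,
          mul_rpow_mul_mul_rpow_mul_mul_rpow _ _ _ ha hb hc, hab, hac, hbc,
          eLpNorm_ofReal_eq_lintegral hp₀, eLpNorm_ofReal_eq_lintegral hq₀]

end Young

/-- The indicator function of `B` divided by `μ B`; convolution with it averages over the translates
of `-B`. -/
noncomputable def averagingKernel {G : Type*} [MeasurableSpace G] (μ : Measure G) (B : Set G) :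
    G → ℝ≥0∞ :=
  B.indicator fun _ => (μ B)⁻¹

section AveragingKernel

variable {G : Type*} [MeasurableSpace G] {μ : Measure G} {B : Set G}

theorem measurable_averagingKernel (hB : MeasurableSet B) : Measurable (averagingKernel μ B) :=
  measurable_const.indicator hB

theorem lintegral_averagingKernel (hB : MeasurableSet B) (hB₀ : μ B ≠ 0) (hB' : μ B ≠ ∞) :
    ∫⁻ x, averagingKernel μ B x ∂μ = 1 := by
  rw [averagingKernel, lintegral_indicator_const hB, ENNReal.inv_mul_cancel hB₀ hB']

end AveragingKernel

section Nash

variable {G F : Type*} [AddCommGroup G] [MeasurableSpace G] [MeasurableAdd₂ G]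
  [MeasurableNeg G] {μ : Measure G} [SFinite μ] [μ.IsAddLeftInvariant] [μ.IsNegInvariant]
  [NormedAddCommGroup F] {f : G → F} {B : Set G} {r : ℝ}

theorem lintegral_mul_mul_averagingKernel_sub_le (hB : MeasurableSet B) (hB₀ : μ B ≠ 0)
    (hB' : μ B ≠ ∞) (hf : AEStronglyMeasurable f μ) (hr₁ : 1 ≤ r) (hr₂ : r ≤ 2) :
    ∫⁻ x, ∫⁻ y, ‖f x‖ₑ * ‖f y‖ₑ * averagingKernel μ B (x - y) ∂μ ∂μ ≤
      μ B ^ (1 - 2 / r) * eLpNorm f (ENNReal.ofReal r) μ ^ 2 := by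
  have hr₀ : 0 < r := one_pos.trans_le hr₁
  have hrr : 1 ≤ 1 / r + 1 / r := by
    rw [← add_div, one_add_one_eq_two, one_le_div hr₀]
    exact hr₂
  have hkernel (x : G) : averagingKernel μ B x = (μ B)⁻¹ * B.indicator 1 x := by
    by_cases hx : x ∈ B <;> simp [averagingKernel, hx]
  calc ∫⁻ x, ∫⁻ y, ‖f x‖ₑ * ‖f y‖ₑ * averagingKernel μ B (x - y) ∂μ ∂μ
      = (μ B)⁻¹ * ∫⁻ x, ∫⁻ y, ‖f x‖ₑ * ‖f y‖ₑ * B.indicator 1 (x - y) ∂μ ∂μ := by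
        simp only [hkernel, mul_left_comm _ (μ B)⁻¹,
          lintegral_const_mul' _ _ (ENNReal.inv_ne_top.2 hB₀)]
    _ ≤ (μ B)⁻¹ * (eLpNorm f (ENNReal.ofReal r) μ * eLpNorm f (ENNReal.ofReal r) μ *
          μ B ^ (2 - 1 / r - 1 / r)) := by
        gcongr
        exact lintegral_mul_mul_indicator_sub_le hB hf hf hr₁ hr₁ hrr
    _ = _ := by
        rw [mul_comm _ (μ B ^ _), ← mul_assoc, ← ENNReal.rpow_neg_one,
          ← ENNReal.rpow_add _ _ hB₀ hB', ← sq]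
        ring_nf

theorem two_mul_eLpNorm_two_sq_le_kernelEnergy_add (hB : MeasurableSet B) (hB₀ : μ B ≠ 0)
    (hB' : μ B ≠ ∞) (hf : AEStronglyMeasurable f μ) (hr₁ : 1 ≤ r) (hr₂ : r ≤ 2) :
    2 * eLpNorm f 2 μ ^ 2 ≤ kernelEnergy μ (averagingKernel μ B) f +
      2 * (μ B ^ (1 - 2 / r) * eLpNorm f (ENNReal.ofReal r) μ ^ 2) := by
  rw [eLpNorm_two_sq_eq_lintegral]
  refine (two_mul_lintegral_enorm_sq_le (measurable_averagingKernel hB).aemeasurable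
    (lintegral_averagingKernel hB hB₀ hB') hf).trans ?_
  gcongr
  exact lintegral_mul_mul_averagingKernel_sub_le hB hB₀ hB' hf hr₁ hr₂

end Nash

section KernelSymbol

open scoped FourierTransform RealInnerProductSpace

variable {E F : Type*} [NormedAddCommGroup E] [InnerProductSpace ℝ E] [MeasurableSpace E]
  [NormedAddCommGroup F]

/-- The symbol `ξ ↦ ∫ (1 - cos ⟪h, ξ⟫) j(h) dμ(h)` of the translation invariant form with kernel
`j`, with values in `[0,∞]` so that no integrability has to be assumed. -/
noncomputable def kernelSymbol (μ : Measure E) (j : E → ℝ≥0∞) (ξ : E) : ℝ≥0∞ :=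
  ∫⁻ h, ENNReal.ofReal (1 - Real.cos ⟪h, ξ⟫) * j h ∂μ

theorem kernelSymbol_averagingKernel_le {μ : Measure E} {B : Set E} (hB : MeasurableSet B)
    (hB₀ : μ B ≠ 0) (hB' : μ B ≠ ∞) {ξ : E} {c : ℝ}
    (hc : ∀ h ∈ B, 1 - Real.cos ⟪h, ξ⟫ ≤ c) :
    kernelSymbol μ (averagingKernel μ B) ξ ≤ ENNReal.ofReal c := by
  calc kernelSymbol μ (averagingKernel μ B) ξ
      ≤ ∫⁻ h, ENNReal.ofReal c * averagingKernel μ B h ∂μ := by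
        refine lintegral_mono fun h => ?_
        by_cases hh : h ∈ B
        · exact mul_le_mul_left (ENNReal.ofReal_le_ofReal (hc h hh)) _
        · simp only [averagingKernel, Set.indicator_of_notMem hh, mul_zero, le_refl]
    _ = ENNReal.ofReal c := by
        rw [lintegral_const_mul _ (measurable_averagingKernel hB),
          lintegral_averagingKernel hB hB₀ hB', mul_one]

variable [FiniteDimensional ℝ E] [BorelSpace E] [InnerProductSpace ℂ F] [CompleteSpace F]
  {f : E → F} {j k : E → ℝ≥0∞}

theorem kernelEnergy_eq_lintegral_kernelSymbol (hj : AEMeasurable j volume)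
    (hf : MemLp f 2 volume) :
    kernelEnergy volume j f = ∫⁻ ξ, 2 * kernelSymbol volume j ((2 * Real.pi) • ξ) *
      ‖(𝓕 (hf.toLp f) : Lp F 2 (volume : Measure E)) ξ‖ₑ ^ 2 := by
  let w (ξ : E) : ℝ≥0∞ := ‖(𝓕 (hf.toLp f) : Lp F 2 (volume : Measure E)) ξ‖ₑ ^ 2
  let c (h ξ : E) : ℝ≥0∞ := ENNReal.ofReal (2 * (1 - Real.cos (2 * Real.pi * ⟪h, ξ⟫)))
  have hw : Measurable w := (Lp.stronglyMeasurable _).enorm.pow_const _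
  have hc : Measurable (Function.uncurry c) :=
    Measurable.ennreal_ofReal (Continuous.measurable (by fun_prop))
  calc kernelEnergy volume j f = ∫⁻ h, (∫⁻ ξ, c h ξ * w ξ) * j h := by
        rw [kernelEnergy_eq_lintegral_translate hj hf.1]
        simp only [lintegral_enorm_sub_translate_sq hf, c, w]
    _ = ∫⁻ h, ∫⁻ ξ, c h ξ * w ξ * j h :=
        lintegral_congr fun h =>
          (lintegral_mul_const _ ((hc.comp measurable_prodMk_left).mul hw)).symm
    _ = ∫⁻ ξ, ∫⁻ h, c h ξ * w ξ * j h :=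
        lintegral_lintegral_swap
          ((hc.mul (hw.comp measurable_snd)).aemeasurable.fun_mul hj.comp_fst)
    _ = ∫⁻ ξ, (∫⁻ h, c h ξ * j h) * w ξ := by
        refine lintegral_congr fun ξ => ?_
        have hcj : AEMeasurable (fun h => c h ξ * j h) volume :=
          (hc.comp measurable_prodMk_right).aemeasurable.fun_mul hj
        rw [← lintegral_mul_const'' _ hcj]
        simp only [mul_right_comm]
    _ = _ := by
        refine lintegral_congr fun ξ => ?_
        rw [kernelSymbol, ← lintegral_const_mul' _ _ ENNReal.ofNat_ne_top]
        simp only [c, ENNReal.ofReal_mul zero_le_two, ENNReal.ofReal_ofNat, inner_smul_right,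
          mul_assoc, w]

theorem kernelEnergy_le_of_kernelSymbol_le (hj : AEMeasurable j volume)
    (hk : AEMeasurable k volume) (hf : MemLp f 2 volume) {C : ℝ≥0∞} (hC : C ≠ ∞)
    (hkj : ∀ ξ, kernelSymbol volume k ξ ≤ C * kernelSymbol volume j ξ) :
    kernelEnergy volume k f ≤ C * kernelEnergy volume j f := by
  rw [kernelEnergy_eq_lintegral_kernelSymbol hk hf, kernelEnergy_eq_lintegral_kernelSymbol hj hf,
    ← lintegral_const_mul' _ _ hC]
  refine lintegral_mono fun ξ => ?_
  rw [← mul_assoc, mul_left_comm C]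
  gcongr
  exact hkj _

end KernelSymbol

theorem one_sub_cos_le_two_mul_rpow {t ρ γ : ℝ} (ht : |t| ≤ ρ) (hγ₀ : 0 ≤ γ) (hγ₂ : γ ≤ 2) :
    1 - Real.cos t ≤ 2 * ρ ^ γ := by
  have hρ : 0 ≤ ρ := (abs_nonneg t).trans ht
  rcases le_total ρ 1 with hρ₁ | hρ₁
  · have hsq : t ^ 2 ≤ ρ ^ 2 := sq_le_sq' (neg_le_of_abs_le ht) (le_of_abs_le ht)
    have hpow : ρ ^ 2 ≤ ρ ^ γ := by
      simpa using Real.rpow_le_rpow_of_exponent_ge' hρ hρ₁ hγ₀ hγ₂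
    linarith [Real.one_sub_sq_div_two_le_cos (x := t), sq_nonneg ρ]
  · linarith [Real.neg_one_le_cos t, Real.one_le_rpow hρ₁ hγ₀]

section LowFrequencyBound

open scoped RealInnerProductSpace

variable {E F : Type*} [NormedAddCommGroup E] [InnerProductSpace ℝ E] {ε γ : ℝ}

theorem one_sub_cos_inner_le {h ξ : E} (hh : ‖h‖ ≤ ε) (hε : 1 ≤ ε) (hγ₀ : 0 ≤ γ) (hγ₂ : γ ≤ 2) :
    1 - Real.cos ⟪h, ξ⟫ ≤ 2 * ε ^ γ * min (‖ξ‖ ^ γ) 1 := by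
  have hε₀ : 0 ≤ ε := zero_le_one.trans hε
  rw [mul_min_of_nonneg _ _ (by positivity)]
  refine le_min ?_ ?_
  · rw [mul_assoc, ← Real.mul_rpow hε₀ (norm_nonneg ξ)]
    exact one_sub_cos_le_two_mul_rpow ((abs_real_inner_le_norm h ξ).trans (by gcongr)) hγ₀ hγ₂
  · linarith [Real.neg_one_le_cos ⟪h, ξ⟫, Real.one_le_rpow hε hγ₀]

variable [MeasurableSpace E] [BorelSpace E] [FiniteDimensional ℝ E] {j : E → ℝ≥0∞} {l : ℝ}

theorem kernelSymbol_averagingKernel_ball_le (hl : 0 < l) (hε : 1 ≤ ε) (hγ₀ : 0 ≤ γ) (hγ₂ : γ ≤ 2)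
    {ξ : E} (hj : ENNReal.ofReal (l * min (‖ξ‖ ^ γ) 1) ≤ kernelSymbol volume j ξ) :
    kernelSymbol volume (averagingKernel volume (Metric.ball 0 ε)) ξ ≤
      ENNReal.ofReal (2 / l * ε ^ γ) * kernelSymbol volume j ξ := by
  have hε₀ : 0 < ε := one_pos.trans_le hε
  calc kernelSymbol volume (averagingKernel volume (Metric.ball 0 ε)) ξ
      ≤ ENNReal.ofReal (2 * ε ^ γ * min (‖ξ‖ ^ γ) 1) :=
        kernelSymbol_averagingKernel_le measurableSet_ball
          (Metric.measure_ball_pos volume 0 hε₀).ne' measure_ball_lt_top.ne fun h hh =>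
          one_sub_cos_inner_le (mem_ball_zero_iff.1 hh).le hε hγ₀ hγ₂
    _ = ENNReal.ofReal (2 / l * ε ^ γ) * ENNReal.ofReal (l * min (‖ξ‖ ^ γ) 1) := by
        rw [← ENNReal.ofReal_mul (by positivity)]
        congr 1
        field_simp
    _ ≤ _ := by gcongr

variable [NormedAddCommGroup F] [InnerProductSpace ℂ F] [CompleteSpace F] {f : E → F} {r : ℝ}

theorem two_mul_eLpNorm_two_sq_le_of_le_kernelSymbol (hl : 0 < l) (hε : 1 ≤ ε) (hγ₀ : 0 ≤ γ)
    (hγ₂ : γ ≤ 2) (hj : AEMeasurable j volume)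
    (hjl : ∀ ξ, ENNReal.ofReal (l * min (‖ξ‖ ^ γ) 1) ≤ kernelSymbol volume j ξ)
    (hf : MemLp f 2 volume) (hr₁ : 1 ≤ r) (hr₂ : r ≤ 2) :
    2 * eLpNorm f 2 volume ^ 2 ≤ ENNReal.ofReal (2 / l * ε ^ γ) * kernelEnergy volume j f +
      2 * (volume (Metric.ball (0 : E) ε) ^ (1 - 2 / r) *
        eLpNorm f (ENNReal.ofReal r) volume ^ 2) := by
  refine (two_mul_eLpNorm_two_sq_le_kernelEnergy_add measurableSet_ball
    (Metric.measure_ball_pos volume (0 : E) (one_pos.trans_le hε)).ne' measure_ball_lt_top.ne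
    hf.1 hr₁ hr₂).trans ?_
  gcongr
  exact kernelEnergy_le_of_kernelSymbol_le hj
    (measurable_averagingKernel measurableSet_ball).aemeasurable hf ENNReal.ofReal_ne_top
    fun ξ => kernelSymbol_averagingKernel_ball_le hl hε hγ₀ hγ₂ (hjl ξ)

end LowFrequencyBound

section CosineTransform

open Filter Topology
open scoped RealInnerProductSpace FourierTransform

theorem exists_pos_forall_le_of_tendsto_cocompact {X : Type*} [TopologicalSpace X] {f : X → ℝ}
    {s : Set X} {L : ℝ} (hs : IsClosed s) (hf : ContinuousOn f s) (hpos : ∀ x ∈ s, 0 < f x)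
    (hL : 0 < L) (hlim : Tendsto f (cocompact X) (𝓝 L)) : ∃ c > 0, ∀ x ∈ s, c ≤ f x := by
  obtain ⟨K, hK, hfK⟩ := mem_cocompact.1 (hlim.eventually (lt_mem_nhds (half_lt_self hL)))
  obtain ⟨c, hc, hcK⟩ : ∃ c > 0, ∀ x ∈ K ∩ s, c ≤ f x := by
    rcases (K ∩ s).eq_empty_or_nonempty with hempty | hne
    · exact ⟨1, one_pos, by simp [hempty]⟩
    · obtain ⟨x₀, hx₀, hmin⟩ := (hK.inter_right hs).exists_isMinOn hne
        (hf.mono Set.inter_subset_right)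
      exact ⟨f x₀, hpos x₀ hx₀.2, fun x hx => hmin hx⟩
  refine ⟨min c (L / 2), lt_min hc (half_pos hL), fun x hx => ?_⟩
  by_cases hxK : x ∈ K
  · exact (min_le_left _ _).trans (hcK x ⟨hxK, hx⟩)
  · exact (min_le_right _ _).trans (le_of_lt (hfK hxK))

theorem one_sub_cos_nonneg (t : ℝ) : 0 ≤ 1 - Real.cos t :=
  sub_nonneg.2 (Real.cos_le_one t)

theorem aemeasurable_of_integrable_mul_min {E : Type*} [NormedAddCommGroup E]
    [MeasurableSpace E] [BorelSpace E] {μ : Measure E} {K : E → ℝ}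
    (hK : Integrable (fun z => K z * min (‖z‖ ^ 2) 1) μ) :
    AEMeasurable K μ := by
  have hoff : AEMeasurable (fun z => K z * min (‖z‖ ^ 2) 1 * (min (‖z‖ ^ 2) 1)⁻¹) μ :=
    hK.aemeasurable.mul (Measurable.aemeasurable (by fun_prop))
  have hzero : Measurable (({0} : Set E).indicator fun _ => K 0) :=
    measurable_const.indicator (measurableSet_singleton 0)
  refine (hoff.add hzero.aemeasurable).congr (Eventually.of_forall fun z => ?_)
  rcases eq_or_ne z 0 with rfl | hz
  · simp
  · have hpos : 0 < min (‖z‖ ^ 2) 1 := lt_min (pow_pos (norm_pos_iff.2 hz) 2) one_pos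
    simp [hz, mul_inv_cancel_right₀ hpos.ne']

variable {E : Type*} [NormedAddCommGroup E] [InnerProductSpace ℝ E]

theorem one_sub_cos_inner_le_mul_min (z ξ : E) :
    1 - Real.cos ⟪z, ξ⟫ ≤ max 2 (‖ξ‖ ^ 2) * min (‖z‖ ^ 2) 1 := by
  rw [mul_min_of_nonneg _ _ (by positivity)]
  refine le_min ?_ ?_
  · have hinner : ⟪z, ξ⟫ ^ 2 ≤ ‖ξ‖ ^ 2 * ‖z‖ ^ 2 := by
      rw [← mul_pow, mul_comm, ← sq_abs]
      gcongr
      exact abs_real_inner_le_norm z ξ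
    have hmax : ‖ξ‖ ^ 2 * ‖z‖ ^ 2 ≤ max 2 (‖ξ‖ ^ 2) * ‖z‖ ^ 2 := by
      gcongr
      exact le_max_right _ _
    linarith [Real.one_sub_sq_div_two_le_cos (x := ⟪z, ξ⟫), sq_nonneg ⟪z, ξ⟫]
  · linarith [Real.neg_one_le_cos ⟪z, ξ⟫, le_max_left 2 (‖ξ‖ ^ 2)]

theorem norm_cos_inner_mul_le (K : E → ℝ) (z ξ : E) : ‖Real.cos ⟪z, ξ⟫ * K z‖ ≤ ‖K z‖ := by
  rw [norm_mul]
  exact mul_le_of_le_one_left (norm_nonneg _) (Real.abs_cos_le_one _)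

variable [MeasurableSpace E] {μ : Measure E} {K : E → ℝ}

theorem integral_one_sub_cos_mul_pos [μ.IsOpenPosMeasure] {ξ : E} (hξ : ξ ≠ 0)
    (hint : Integrable (fun z => (1 - Real.cos ⟪z, ξ⟫) * K z) μ) (hK : ∀ z, 0 ≤ K z)
    (hpos : ∃ δ > 0, ∀ z, z ≠ 0 → ‖z‖ < δ → 0 < K z) :
    0 < ∫ z, (1 - Real.cos ⟪z, ξ⟫) * K z ∂μ := by
  obtain ⟨δ, hδ, hpos⟩ := hpos
  rw [integral_pos_iff_support_of_nonneg (fun z => mul_nonneg (one_sub_cos_nonneg _) (hK z)) hint]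
  let U : Set E := Metric.ball 0 δ ∩ (fun z => ⟪z, ξ⟫) ⁻¹' Set.Ioo 0 1
  have hU : IsOpen U := Metric.isOpen_ball.inter (isOpen_Ioo.preimage (by fun_prop))
  have hne : U.Nonempty := by
    have hsmall : ∀ᶠ t : ℝ in 𝓝[>] 0, ‖t • ξ‖ < δ ∧ ⟪t • ξ, ξ⟫ < 1 := by
      refine nhdsWithin_le_nhds (Eventually.and ?_ ?_)
      · exact ContinuousAt.eventually_lt (by fun_prop) continuousAt_const (by simpa using hδ)
      · exact ContinuousAt.eventually_lt (by fun_prop) continuousAt_const (by simp)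
    obtain ⟨t, ⟨hball, hlt⟩, ht⟩ := (hsmall.and self_mem_nhdsWithin).exists
    refine ⟨t • ξ, mem_ball_zero_iff.2 hball, ?_, hlt⟩
    change 0 < ⟪t • ξ, ξ⟫
    rw [real_inner_smul_left]
    exact mul_pos ht (real_inner_self_pos.2 hξ)
  refine (hU.measure_pos μ hne).trans_le (measure_mono ?_)
  rintro z ⟨hball, hinner₀, hinner₁⟩
  have hz : z ≠ 0 := by
    rintro rfl
    exact hinner₀.ne' (inner_zero_left ξ)
  have hcos : Real.cos ⟪z, ξ⟫ < 1 := by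
    simpa using Real.cos_lt_cos_of_nonneg_of_le_pi le_rfl
      (hinner₁.le.trans (by linarith [Real.pi_gt_three])) hinner₀
  exact (mul_pos (sub_pos.2 hcos) (hpos z hz (mem_ball_zero_iff.1 hball))).ne'

variable [BorelSpace E]

theorem integrable_one_sub_cos_mul (hK : Integrable (fun z => K z * min (‖z‖ ^ 2) 1) μ) (ξ : E) :
    Integrable (fun z => (1 - Real.cos ⟪z, ξ⟫) * K z) μ := by
  have hcos : Measurable fun z : E => 1 - Real.cos ⟪z, ξ⟫ := Continuous.measurable (by fun_prop)
  refine (hK.norm.const_mul (max 2 (‖ξ‖ ^ 2))).mono'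
    (hcos.aemeasurable.mul (aemeasurable_of_integrable_mul_min hK)).aestronglyMeasurable
    (Eventually.of_forall fun z => ?_)
  rw [norm_mul, norm_mul, Real.norm_of_nonneg (one_sub_cos_nonneg _),
    Real.norm_of_nonneg (by positivity : 0 ≤ min (‖z‖ ^ 2) 1), mul_left_comm, mul_comm _ ‖K z‖]
  gcongr
  exact one_sub_cos_inner_le_mul_min z ξ

theorem integrable_cos_inner_mul (hK : Integrable K μ) (ξ : E) :
    Integrable (fun z => Real.cos ⟪z, ξ⟫ * K z) μ :=
  hK.mono (.mul (Measurable.aestronglyMeasurable (Continuous.measurable (by fun_prop))) hK.1)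
    (Eventually.of_forall fun z => norm_cos_inner_mul_le K z ξ)

theorem continuous_integral_cos_inner_mul (hK : Integrable K μ) :
    Continuous fun ξ : E => ∫ z, Real.cos ⟪z, ξ⟫ * K z ∂μ :=
  continuous_of_dominated (fun ξ => (integrable_cos_inner_mul hK ξ).1)
    (fun ξ => Eventually.of_forall fun z => norm_cos_inner_mul_le K z ξ) hK.norm
    (Eventually.of_forall fun z => by fun_prop)

theorem integral_one_sub_cos_mul_eq_sub (hK : Integrable K μ) (ξ : E) :
    ∫ z, (1 - Real.cos ⟪z, ξ⟫) * K z ∂μ = ∫ z, K z ∂μ - ∫ z, Real.cos ⟪z, ξ⟫ * K z ∂μ := by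
  rw [← integral_sub hK (integrable_cos_inner_mul hK ξ)]
  simp only [sub_mul, one_mul]

variable [FiniteDimensional ℝ E]

theorem tendsto_integral_cos_inner_mul_cocompact (hK : Integrable K volume) :
    Tendsto (fun ξ : E => ∫ z, Real.cos ⟪z, ξ⟫ * K z) (cocompact E) (𝓝 0) := by
  let scale : E ≃ₜ E := Homeomorph.smulOfNeZero (2 * Real.pi)⁻¹ (by positivity)
  have hlim := (Complex.continuous_re.tendsto 0).comp
    ((tendsto_integral_exp_inner_smul_cocompact (V := E) fun z => (K z : ℂ)).comp
      scale.isClosedEmbedding.tendsto_cocompact)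
  refine hlim.congr fun ξ => ?_
  have hint : Integrable (fun z => 𝐞 (-⟪z, scale ξ⟫) • (K z : ℂ)) :=
    (Real.fourierIntegral_convergent_iff (scale ξ)).2 hK.ofReal
  refine (integral_re hint).symm.trans (integral_congr_ae (Eventually.of_forall fun z => ?_))
  have hphase : 2 * Real.pi * -((2 * Real.pi)⁻¹ * ⟪z, ξ⟫) = -⟪z, ξ⟫ := by field_simp
  simp only [scale, Homeomorph.smulOfNeZero_apply, RCLike.re_eq_complex_re, Circle.smul_def,
    smul_eq_mul, Complex.re_mul_ofReal, Real.fourierChar_apply, inner_smul_right]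
  rw [hphase, Complex.exp_ofReal_mul_I_re, Real.cos_neg]

theorem exists_pos_forall_le_integral_one_sub_cos_mul (hK : Integrable K volume)
    (hK₀ : ∀ z, 0 ≤ K z) (hpos : ∃ δ > 0, ∀ z, z ≠ 0 → ‖z‖ < δ → 0 < K z) :
    ∃ c > 0, ∀ ξ : E, 1 ≤ ‖ξ‖ → c ≤ ∫ z, (1 - Real.cos ⟪z, ξ⟫) * K z := by
  rcases subsingleton_or_nontrivial E with _ | _
  · exact ⟨1, one_pos, fun ξ hξ => absurd hξ (by simp [Subsingleton.elim ξ 0])⟩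
  have hint (ξ : E) : Integrable fun z => (1 - Real.cos ⟪z, ξ⟫) * K z :=
    (hK.sub (integrable_cos_inner_mul hK ξ)).congr
      (Eventually.of_forall fun z => (one_sub_mul _ _).symm)
  have hm {ξ : E} (hξ : ξ ≠ 0) : 0 < ∫ z, (1 - Real.cos ⟪z, ξ⟫) * K z :=
    integral_one_sub_cos_mul_pos hξ (hint ξ) hK₀ hpos
  simp only [integral_one_sub_cos_mul_eq_sub hK] at hm ⊢
  have hmass : 0 < ∫ z, K z := by
    obtain ⟨ξ, hξ⟩ := exists_ne (0 : E)
    have hcos : |∫ z, Real.cos ⟪z, ξ⟫ * K z| ≤ ∫ z, K z :=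
      norm_integral_le_of_norm_le hK <| Eventually.of_forall fun z =>
        (norm_cos_inner_mul_le K z ξ).trans_eq (Real.norm_of_nonneg (hK₀ z))
    linarith [hm hξ, neg_le_of_abs_le hcos]
  refine exists_pos_forall_le_of_tendsto_cocompact (s := {ξ : E | 1 ≤ ‖ξ‖})
    (isClosed_le continuous_const continuous_norm)
    (continuous_const.sub (continuous_integral_cos_inner_mul hK)).continuousOn
    (fun ξ hξ => hm (norm_pos_iff.1 (one_pos.trans_le hξ))) hmass ?_
  simpa only [sub_zero] using tendsto_const_nhds.sub (tendsto_integral_cos_inner_mul_cocompact hK)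

end CosineTransform

section LevyKernel

variable {N : ℕ} {J f : EuclideanSpace ℝ (Fin N) → ℝ} {γ κ : ℝ}

theorem multiplier_nonneg (hJ : ∀ z, 0 ≤ J z) (ξ : EuclideanSpace ℝ (Fin N)) :
    0 ≤ multiplier J ξ :=
  integral_nonneg fun z => mul_nonneg (one_sub_cos_nonneg _) (hJ z)

theorem multiplierInf_nonneg (hJ : ∀ z, 0 ≤ J z) : 0 ≤ multiplierInf J :=
  Real.iInf_nonneg fun ξ => multiplier_nonneg hJ ξ

theorem multiplierInf_le (hJ : ∀ z, 0 ≤ J z) {ξ : EuclideanSpace ℝ (Fin N)} (hξ : 1 ≤ ‖ξ‖) :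
    multiplierInf J ≤ multiplier J ξ :=
  ciInf_le (f := fun ξ : {ξ : EuclideanSpace ℝ (Fin N) // 1 ≤ ‖ξ‖} => multiplier J ξ)
    ⟨0, Set.forall_mem_range.2 fun ξ => multiplier_nonneg hJ ξ⟩ ⟨ξ, hξ⟩

theorem multiplierInf_pos (hN : 1 ≤ N) (hJ : ∀ z, 0 ≤ J z)
    (hpos : ∃ δ > 0, ∀ z, z ≠ 0 → ‖z‖ < δ → 0 < J z)
    (hint : Integrable (fun z => J z * min (‖z‖ ^ 2) 1) volume) : 0 < multiplierInf J := by
  have : Nonempty (Fin N) := ⟨⟨0, hN⟩⟩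
  have : Nonempty {ξ : EuclideanSpace ℝ (Fin N) // 1 ≤ ‖ξ‖} :=
    (exists_norm_eq (EuclideanSpace ℝ (Fin N)) zero_le_one).elim fun ξ hξ => ⟨ξ, hξ.ge⟩
  have hmin {z : EuclideanSpace ℝ (Fin N)} (hz : z ≠ 0) : 0 < min (‖z‖ ^ 2) 1 :=
    lt_min (pow_pos (norm_pos_iff.2 hz) 2) one_pos
  -- Unlike `J`, its minorant `J(z) (|z|² ∧ 1)` is integrable, which Riemann–Lebesgue requires.
  obtain ⟨c, hc, hcK⟩ := exists_pos_forall_le_integral_one_sub_cos_mul hint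
    (fun z => mul_nonneg (hJ z) (by positivity)) <|
    hpos.imp fun δ hδ => ⟨hδ.1, fun z hz hzδ => mul_pos (hδ.2 z hz hzδ) (hmin hz)⟩
  refine hc.trans_le (le_ciInf fun ξ => (hcK ξ ξ.2).trans ?_)
  refine integral_mono_of_nonneg ?_ (integrable_one_sub_cos_mul hint ξ) ?_ <;>
    refine Filter.Eventually.of_forall fun z => ?_
  · exact mul_nonneg (one_sub_cos_nonneg _) (mul_nonneg (hJ z) (by positivity))
  · exact mul_le_mul_of_nonneg_left (mul_le_of_le_one_right (hJ z) (min_le_right _ _))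
      (one_sub_cos_nonneg _)

theorem kernelSymbol_ofReal (hJ : ∀ z, 0 ≤ J z)
    (hint : Integrable (fun z => J z * min (‖z‖ ^ 2) 1) volume) (ξ : EuclideanSpace ℝ (Fin N)) :
    kernelSymbol volume (fun h => ENNReal.ofReal (J h)) ξ = ENNReal.ofReal (multiplier J ξ) := by
  rw [multiplier, ofReal_integral_eq_lintegral_ofReal (integrable_one_sub_cos_mul hint ξ)
    (Filter.Eventually.of_forall fun h => mul_nonneg (one_sub_cos_nonneg _) (hJ h))]
  exact lintegral_congr fun h => (ENNReal.ofReal_mul (one_sub_cos_nonneg _)).symm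

theorem min_mul_min_rpow_le_multiplier (hJ : ∀ z, 0 ≤ J z) (hκ : 0 ≤ κ)
    (hm : ∀ ξ : EuclideanSpace ℝ (Fin N), ‖ξ‖ ≤ 1 → κ * ‖ξ‖ ^ γ ≤ multiplier J ξ)
    (ξ : EuclideanSpace ℝ (Fin N)) :
    min κ (multiplierInf J) * min (‖ξ‖ ^ γ) 1 ≤ multiplier J ξ := by
  rcases le_total ‖ξ‖ 1 with hξ | hξ
  · exact (mul_le_mul (min_le_left _ _) (min_le_left _ _) (by positivity) hκ).trans (hm ξ hξ)
  · refine (mul_le_mul (min_le_right _ _) (min_le_right _ _) (by positivity)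
      (multiplierInf_nonneg hJ)).trans ?_
    rw [mul_one]
    exact multiplierInf_le hJ hξ

theorem two_mul_dirichletForm (J f : EuclideanSpace ℝ (Fin N) → ℝ) :
    2 * dirichletForm J f =
      kernelEnergy volume (fun h => ENNReal.ofReal (J h)) fun x => (f x : ℂ) := by
  rw [dirichletForm, ← mul_assoc, ENNReal.mul_inv_cancel two_ne_zero ENNReal.ofNat_ne_top, one_mul,
    kernelEnergy]
  refine lintegral_congr fun x => lintegral_congr fun y => ?_
  rw [ENNReal.ofReal_mul (sq_nonneg _), ← Complex.ofReal_sub, ← ofReal_norm, Complex.norm_real,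
    ← ENNReal.ofReal_pow (norm_nonneg _), Real.norm_eq_abs, sq_abs]

theorem eLpNorm_two_sq_le_dirichletForm_add {l r ε : ℝ} (hJ : ∀ z, 0 ≤ J z)
    (hint : Integrable (fun z => J z * min (‖z‖ ^ 2) 1) volume) (hl : 0 < l)
    (hm : ∀ ξ : EuclideanSpace ℝ (Fin N), l * min (‖ξ‖ ^ γ) 1 ≤ multiplier J ξ)
    (hγ₀ : 0 ≤ γ) (hγ₂ : γ ≤ 2) (hr₁ : 1 ≤ r) (hr₂ : r ≤ 2) (hf : MemLp f 2 volume) (hε : 1 ≤ ε) :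
    eLpNorm f 2 volume ^ 2 ≤ ENNReal.ofReal (2 / l * ε ^ γ) * dirichletForm J f +
      volume (Metric.ball (0 : EuclideanSpace ℝ (Fin N)) ε) ^ (1 - 2 / r) *
        eLpNorm f (ENNReal.ofReal r) volume ^ 2 := by
  have hnorm (p : ℝ≥0∞) : eLpNorm (fun x => (f x : ℂ)) p volume = eLpNorm f p volume :=
    eLpNorm_congr_norm_ae (Filter.Eventually.of_forall fun x => Complex.norm_real (f x))
  have hf' : MemLp (fun x => (f x : ℂ)) 2 volume := hf.ofReal
  have hnash := two_mul_eLpNorm_two_sq_le_of_le_kernelSymbol hl hε hγ₀ hγ₂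
    (aemeasurable_of_integrable_mul_min hint).ennreal_ofReal
    (fun ξ => (ENNReal.ofReal_le_ofReal (hm ξ)).trans_eq (kernelSymbol_ofReal hJ hint ξ).symm)
    hf' hr₁ hr₂
  rw [hnorm, hnorm, ← two_mul_dirichletForm, mul_left_comm, ← mul_add] at hnash
  exact (ENNReal.mul_le_mul_iff_right two_ne_zero ENNReal.ofNat_ne_top).1 hnash

end LevyKernel

theorem eLpNorm_le_eLpNorm_rpow_mul_eLpNorm_rpow {α F : Type*} [MeasurableSpace α]
    [NormedAddCommGroup F] {μ : Measure α} {f : α → F} (hf : AEStronglyMeasurable f μ)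
    {p q s t u : ℝ} (hp : 0 < p) (hq : 0 < q) (hs : 0 < s) (ht : 0 ≤ t) (hu : 0 ≤ u)
    (htu : t + u = 1) (hst : 1 / s = t / p + u / q) :
    eLpNorm f (ENNReal.ofReal s) μ ≤
      eLpNorm f (ENNReal.ofReal p) μ ^ t * eLpNorm f (ENNReal.ofReal q) μ ^ u := by
  have hweights : s * (t / p) + s * (u / q) = 1 := by
    rw [← mul_add, ← hst, mul_one_div_cancel hs.ne']
  have hpow (x : α) : (‖f x‖ₑ ^ p) ^ (s * (t / p)) * (‖f x‖ₑ ^ q) ^ (s * (u / q)) =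
      ‖f x‖ₑ ^ s := by
    rw [← ENNReal.rpow_mul, ← ENNReal.rpow_mul,
      ← ENNReal.rpow_add_of_nonneg _ _ (by positivity) (by positivity)]
    congr 1
    field_simp
    exact htu
  have holder := ENNReal.lintegral_mul_norm_pow_le (hf.enorm.pow_const p) (hf.enorm.pow_const q)
    (by positivity) (by positivity) hweights
  simp only [hpow] at holder
  calc eLpNorm f (ENNReal.ofReal s) μ = (∫⁻ x, ‖f x‖ₑ ^ s ∂μ) ^ (1 / s) :=
        eLpNorm_ofReal_eq_lintegral hs f
    _ ≤ ((∫⁻ x, ‖f x‖ₑ ^ p ∂μ) ^ (s * (t / p)) *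
          (∫⁻ x, ‖f x‖ₑ ^ q ∂μ) ^ (s * (u / q))) ^ (1 / s) := by gcongr
    _ = _ := by
        rw [ENNReal.mul_rpow_of_nonneg _ _ (by positivity), eLpNorm_ofReal_eq_lintegral hp,
          eLpNorm_ofReal_eq_lintegral hq]
        simp only [← ENNReal.rpow_mul]
        congr 2 <;> field_simp

section RealLpNorm

variable {N : ℕ} {f : EuclideanSpace ℝ (Fin N) → ℝ} {γ r s : ℝ}

theorem realLpNorm_nonneg (p : ℝ) (f : EuclideanSpace ℝ (Fin N) → ℝ) : 0 ≤ realLpNorm p f :=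
  ENNReal.toReal_nonneg

theorem realLpNorm_eq_zero_of_realLpNorm_eq_zero (hr : 0 < r)
    (hfr : MemLp f (ENNReal.ofReal r) volume) (hf₀ : realLpNorm r f = 0) :
    realLpNorm s f = 0 := by
  have hae : f =ᵐ[volume] 0 := (eLpNorm_eq_zero_iff hfr.1 (by simpa using hr)).1 <|
    ((ENNReal.toReal_eq_zero_iff _).1 hf₀).resolve_right hfr.2.ne
  rw [realLpNorm, eLpNorm_congr_ae hae, eLpNorm_zero, ENNReal.toReal_zero]

theorem one_sub_theta₂ (hr : r < 2) (hs : 0 < s) :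
    1 - theta₂ r s = 2 * (s - r) / (s * (2 - r)) := by
  have hr' : 0 < 2 - r := sub_pos.2 hr
  rw [theta₂]
  field_simp
  ring

theorem one_sub_theta₁ (hN : 1 ≤ N) (hγ₀ : 0 ≤ γ) (hr₀ : 0 ≤ r) (hr : r < 2) (hs : 0 < s) :
    1 - theta₁ N γ r s = 2 * N * (s - r) / (s * (N * (2 - r) + γ * r)) := by
  have : (0 : ℝ) < N := Nat.cast_pos.2 hN
  have hr' : 0 < 2 - r := sub_pos.2 hr
  have : 0 < N * (2 - r) + γ * r := by positivity
  rw [theta₁]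
  field_simp
  ring

theorem theta₂_lt_one (hr₀ : 0 < r) (hrs : r < s) (hs : s ≤ 2) : theta₂ r s < 1 := by
  have hs₀ : 0 < s := hr₀.trans hrs
  have hr : r < 2 := hrs.trans_le hs
  rw [← sub_pos, one_sub_theta₂ hr hs₀]
  exact div_pos (mul_pos two_pos (sub_pos.2 hrs)) (mul_pos hs₀ (sub_pos.2 hr))

theorem theta₁_lt_one (hN : 1 ≤ N) (hγ₀ : 0 ≤ γ) (hr₀ : 0 < r) (hrs : r < s) (hs : s ≤ 2) :
    theta₁ N γ r s < 1 := by
  have hs₀ : 0 < s := hr₀.trans hrs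
  have hr : r < 2 := hrs.trans_le hs
  have : (0 : ℝ) < N := Nat.cast_pos.2 hN
  have : 0 < s - r := sub_pos.2 hrs
  have : 0 < 2 - r := sub_pos.2 hr
  rw [← sub_pos, one_sub_theta₁ hN hγ₀ hr₀.le hr hs₀]
  positivity

theorem one_sub_theta₂_div_one_sub_theta₁ (hN : 1 ≤ N) (hγ₀ : 0 ≤ γ) (hr₀ : 0 < r) (hrs : r < s)
    (hs : s ≤ 2) :
    (1 - theta₂ r s) / (1 - theta₁ N γ r s) = 1 + γ / (N * (2 / r - 1)) := by
  have : (0 : ℝ) < N := Nat.cast_pos.2 hN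
  have hr' : 0 < 2 - r := by linarith
  have hsr : 0 < s - r := sub_pos.2 hrs
  have hs₀ : 0 < s := hr₀.trans hrs
  have hr₂ : r < 2 := hrs.trans_le hs
  have : 0 < N * (2 - r) + γ * r := by positivity
  rw [one_sub_theta₁ hN hγ₀ hr₀.le hr₂ hs₀, one_sub_theta₂ hr₂ hs₀, div_sub_one hr₀.ne']
  field_simp

theorem realLpNorm_le_rpow_mul_rpow (hr : 0 < r) (hrs : r < s) (hs : s ≤ 2)
    (hf : MemLp f 2 volume) (hfr : MemLp f (ENNReal.ofReal r) volume) :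
    realLpNorm s f ≤ realLpNorm r f ^ theta₂ r s * realLpNorm 2 f ^ (1 - theta₂ r s) := by
  have hr₂ : 0 < 2 - r := by linarith
  have hs₀ : 0 < s := hr.trans hrs
  have : 0 ≤ 2 - s := sub_nonneg.2 hs
  have hθ₂ : 0 ≤ theta₂ r s := by
    rw [theta₂]
    positivity
  have hθ₂' : 0 ≤ 1 - theta₂ r s := (sub_pos.2 (theta₂_lt_one hr hrs hs)).le
  have hweights : 1 / s = theta₂ r s / r + (1 - theta₂ r s) / 2 := by
    rw [theta₂]
    field_simp
    ring
  have hinterp := eLpNorm_le_eLpNorm_rpow_mul_eLpNorm_rpow hf.1 hr two_pos hs₀ hθ₂ hθ₂'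
    (add_sub_cancel _ _) hweights
  have hf' : eLpNorm f (ENNReal.ofReal 2) volume ≠ ∞ := by simpa using hf.2.ne
  have hfin := ENNReal.mul_ne_top (ENNReal.rpow_ne_top_of_nonneg hθ₂ hfr.2.ne)
    (ENNReal.rpow_ne_top_of_nonneg hθ₂' hf')
  simpa only [realLpNorm, ENNReal.toReal_mul, ENNReal.toReal_rpow] using
    ENNReal.toReal_mono hfin hinterp

end RealLpNorm

/-- The constant of the Nash inequality
`‖f‖_2² ≤ nashConstant N r l * (ε^γ E(f,f) + ε^(-N(2/r-1)) ‖f‖_r²)` for `1 ≤ ε`, where the symbol of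
the kernel is at least `l min(|ξ|^γ, 1)`. The summand `1` only serves to have a constant `≥ 1`. -/
noncomputable def nashConstant (N : ℕ) (r l : ℝ) : ℝ :=
  1 + 2 / l + volume.real (Metric.ball (0 : EuclideanSpace ℝ (Fin N)) 1) ^ (1 - 2 / r)

theorem one_le_nashConstant (N : ℕ) (r : ℝ) {l : ℝ} (hl : 0 < l) : 1 ≤ nashConstant N r l := by
  rw [nashConstant, add_assoc]
  exact le_add_of_nonneg_right (by positivity)

theorem toReal_volume_ball_rpow {N : ℕ} {ε : ℝ} (hε : 0 < ε) (p : ℝ) :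
    (volume (Metric.ball (0 : EuclideanSpace ℝ (Fin N)) ε) ^ p).toReal =
      ε ^ (N * p) * volume.real (Metric.ball (0 : EuclideanSpace ℝ (Fin N)) 1) ^ p := by
  rw [Measure.addHaar_ball_of_pos _ _ hε, finrank_euclideanSpace_fin, ← ENNReal.toReal_rpow,
    ENNReal.toReal_mul, ENNReal.toReal_ofReal (by positivity), Real.mul_rpow (by positivity)
    ENNReal.toReal_nonneg, Real.rpow_mul hε.le, Real.rpow_natCast, measureReal_def]

theorem realLpNorm_two_sq_le {N : ℕ} {J f : EuclideanSpace ℝ (Fin N) → ℝ} {γ l r ε : ℝ}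
    (hJ : ∀ z, 0 ≤ J z) (hint : Integrable (fun z => J z * min (‖z‖ ^ 2) 1) volume) (hl : 0 < l)
    (hm : ∀ ξ : EuclideanSpace ℝ (Fin N), l * min (‖ξ‖ ^ γ) 1 ≤ multiplier J ξ)
    (hγ₀ : 0 ≤ γ) (hγ₂ : γ ≤ 2) (hr₁ : 1 ≤ r) (hr₂ : r ≤ 2) (hf : MemLp f 2 volume)
    (hfr : MemLp f (ENNReal.ofReal r) volume) (hE : dirichletForm J f ≠ ∞) (hε : 1 ≤ ε) :
    realLpNorm 2 f ^ 2 ≤ nashConstant N r l *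
      (ε ^ γ * (dirichletForm J f).toReal + ε ^ (-(N * (2 / r - 1))) * realLpNorm r f ^ 2) := by
  have hε₀ : 0 < ε := one_pos.trans_le hε
  have hball : volume (Metric.ball (0 : EuclideanSpace ℝ (Fin N)) ε) ^ (1 - 2 / r) ≠ ∞ :=
    ENNReal.rpow_ne_top_of_ne_zero (Metric.measure_ball_pos volume 0 hε₀).ne' measure_ball_lt_top.ne
  have hnash := ENNReal.toReal_mono (by finiteness [hfr.2.ne])
    (eLpNorm_two_sq_le_dirichletForm_add hJ hint hl hm hγ₀ hγ₂ hr₁ hr₂ hf hε)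
  rw [ENNReal.toReal_add (by finiteness) (by finiteness [hfr.2.ne]), ENNReal.toReal_mul,
    ENNReal.toReal_mul, ENNReal.toReal_pow, ENNReal.toReal_pow, toReal_volume_ball_rpow hε₀,
    ENNReal.toReal_ofReal (by positivity)] at hnash
  have hexponent : (N : ℝ) * (1 - 2 / r) = -(N * (2 / r - 1)) := by ring
  rw [hexponent] at hnash
  let V : ℝ := volume.real (Metric.ball (0 : EuclideanSpace ℝ (Fin N)) 1) ^ (1 - 2 / r)
  have hV : 0 ≤ V := by positivity
  have hK₁ : 2 / l ≤ nashConstant N r l := by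
    rw [nashConstant]
    linarith
  have hK₂ : V ≤ nashConstant N r l := by
    rw [nashConstant]
    linarith [div_pos two_pos hl]
  calc realLpNorm 2 f ^ 2
      ≤ 2 / l * (ε ^ γ * (dirichletForm J f).toReal) +
          V * (ε ^ (-(N * (2 / r - 1))) * realLpNorm r f ^ 2) := by
        rw [← mul_assoc, ← mul_assoc, mul_comm V]
        simpa only [realLpNorm, ENNReal.ofReal_ofNat] using hnash
    _ ≤ nashConstant N r l * (ε ^ γ * (dirichletForm J f).toReal) +
          nashConstant N r l * (ε ^ (-(N * (2 / r - 1))) * realLpNorm r f ^ 2) := by gcongr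
    _ = _ := (mul_add _ _ _).symm

theorem rpow_mul_rpow_le_of_forall_one_le {a b γ K x y D : ℝ} (ha : 0 < a) (hγ : 0 ≤ γ)
    (hab : a * b = a + γ) (hb : 0 ≤ b) (hK : 0 ≤ K) (hx : 0 ≤ x) (hD : 0 < D) (hDy : D ≤ y)
    (h : ∀ ε, 1 ≤ ε → x ≤ K * (ε ^ γ * D + ε ^ (-a) * y)) :
    x ^ b * y ^ (1 - b) ≤ (2 * K) ^ b * D := by
  have hy : 0 < y := hD.trans_le hDy
  have haγ : 0 < a + γ := by positivity
  -- This `ε` makes the two summands in `h` equal, and `D ≤ y` makes it admissible.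
  let ε : ℝ := (y / D) ^ (1 / (a + γ))
  have hε : 1 ≤ ε := Real.one_le_rpow ((one_le_div hD).2 hDy) (by positivity)
  have hε₀ : 0 < ε := one_pos.trans_le hε
  have hεpow : ε ^ (a + γ) = y / D := by
    rw [← Real.rpow_mul (by positivity), one_div_mul_cancel haγ.ne', Real.rpow_one]
  have hbalance : ε ^ γ * D = ε ^ (-a) * y := by
    rw [show γ = -a + (a + γ) by ring, Real.rpow_add hε₀, hεpow]
    field_simp
  have hxε : x ≤ 2 * K * (ε ^ (-a) * y) := by
    linarith [hbalance ▸ h ε hε]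
  calc x ^ b * y ^ (1 - b) ≤ (2 * K * (ε ^ (-a) * y)) ^ b * y ^ (1 - b) := by gcongr
    _ = (2 * K) ^ b * (ε ^ (a + γ))⁻¹ * (y ^ b * y ^ (1 - b)) := by
        rw [Real.mul_rpow (by positivity) (by positivity), Real.mul_rpow (by positivity) hy.le,
          ← Real.rpow_mul hε₀.le, neg_mul, hab, Real.rpow_neg hε₀.le]
        ring
    _ = (2 * K) ^ b * D := by
        rw [← Real.rpow_add hy, add_sub_cancel, Real.rpow_one, hεpow]
        field_simp

theorem min_rpow_mul_rpow_le {a b γ K x y D : ℝ} (ha : 0 < a) (hγ : 0 ≤ γ) (hab : a * b = a + γ)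
    (hK : 1 ≤ K) (hx : 0 ≤ x) (hD : 0 ≤ D)
    (h : ∀ ε, 1 ≤ ε → x ≤ K * (ε ^ γ * D + ε ^ (-a) * y)) :
    min (x ^ b * y ^ (1 - b)) x ≤ (2 * K) ^ b * D := by
  have hb : 1 ≤ b := by
    refine le_of_mul_le_mul_left ?_ ha
    linarith
  rcases hD.eq_or_lt with rfl | hD₀
  · have hlim : Filter.Tendsto (fun ε : ℝ => K * (ε ^ γ * 0 + ε ^ (-a) * y)) Filter.atTop
        (nhds 0) := by
      simpa using ((tendsto_rpow_neg_atTop ha).mul_const y).const_mul K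
    rw [mul_zero]
    exact (min_le_right _ _).trans
      (ge_of_tendsto hlim ((Filter.eventually_ge_atTop 1).mono h))
  rcases le_total y D with hyD | hDy
  · have hK₂ : 1 ≤ 2 * K := by linarith
    calc min (x ^ b * y ^ (1 - b)) x ≤ K * (D + y) := by
          simpa only [Real.one_rpow, one_mul] using (min_le_right _ _).trans (h 1 le_rfl)
      _ ≤ K * (D + D) := by gcongr
      _ = (2 * K) ^ (1 : ℝ) * D := by
          rw [Real.rpow_one]
          ring
      _ ≤ (2 * K) ^ b * D := by gcongr
  · exact (min_le_left _ _).trans <| rpow_mul_rpow_le_of_forall_one_le ha hγ hab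
      (zero_le_one.trans hb) (zero_le_one.trans hK) hx hD₀ hDy h

theorem rpow_le_of_le_rpow_mul_rpow {p q σ θ θ' : ℝ} (hp : 0 < p) (hq : 0 ≤ q) (hσ : 0 ≤ σ)
    (hθ : θ < 1) (h : σ ≤ p ^ θ' * q ^ (1 - θ')) :
    (σ * p ^ (-θ)) ^ (2 / (1 - θ)) ≤
      (q ^ 2) ^ ((1 - θ') / (1 - θ)) * (p ^ 2) ^ (1 - (1 - θ') / (1 - θ)) := by
  have hθ' : 0 < 1 - θ := sub_pos.2 hθ
  calc (σ * p ^ (-θ)) ^ (2 / (1 - θ))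
      ≤ (p ^ θ' * q ^ (1 - θ') * p ^ (-θ)) ^ (2 / (1 - θ)) := by gcongr
    _ = (q ^ (1 - θ') * p ^ (θ' - θ)) ^ (2 / (1 - θ)) := by
        rw [sub_eq_add_neg θ', Real.rpow_add hp]
        ring_nf
    _ = _ := by
        rw [Real.mul_rpow (by positivity) (by positivity), ← Real.rpow_natCast q,
          ← Real.rpow_natCast p]
        simp only [← Real.rpow_mul hq, ← Real.rpow_mul hp.le]
        congr 2 <;> field_simp <;> ring

theorem min_rpow_realLpNorm_le {N : ℕ} (hN : 1 ≤ N) {J f : EuclideanSpace ℝ (Fin N) → ℝ}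
    {γ l r s : ℝ} (hJ : ∀ z, 0 ≤ J z) (hint : Integrable (fun z => J z * min (‖z‖ ^ 2) 1) volume)
    (hl : 0 < l) (hm : ∀ ξ : EuclideanSpace ℝ (Fin N), l * min (‖ξ‖ ^ γ) 1 ≤ multiplier J ξ)
    (hγ₀ : 0 ≤ γ) (hγ₂ : γ ≤ 2) (hr : 1 ≤ r) (hrs : r < s) (hs : s ≤ 2) (hf : MemLp f 2 volume)
    (hfr : MemLp f (ENNReal.ofReal r) volume) (hE : dirichletForm J f ≠ ∞) :
    min
        ((realLpNorm s f * realLpNorm r f ^ (-theta₁ N γ r s)) ^ (2 / (1 - theta₁ N γ r s)))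
        ((realLpNorm s f * realLpNorm r f ^ (-theta₂ r s)) ^ (2 / (1 - theta₂ r s))) ≤
      (2 * nashConstant N r l) ^ ((1 - theta₂ r s) / (1 - theta₁ N γ r s)) *
        (dirichletForm J f).toReal := by
  have hr₀ : 0 < r := one_pos.trans_le hr
  have hr₂ : r < 2 := hrs.trans_le hs
  have hθ₁ : 0 < 1 - theta₁ N γ r s := sub_pos.2 (theta₁_lt_one hN hγ₀ hr₀ hrs hs)
  have hθ₂ : 0 < 1 - theta₂ r s := sub_pos.2 (theta₂_lt_one hr₀ hrs hs)
  have hK := one_le_nashConstant N r hl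
  rcases (realLpNorm_nonneg r f).eq_or_lt with hp | hp
  · rw [realLpNorm_eq_zero_of_realLpNorm_eq_zero hr₀ hfr hp.symm, zero_mul, zero_mul,
      Real.zero_rpow (by positivity), Real.zero_rpow (by positivity), min_self]
    positivity
  have ha : 0 < N * (2 / r - 1) :=
    mul_pos (Nat.cast_pos.2 hN) (sub_pos.2 ((one_lt_div hr₀).2 hr₂))
  have hinterp := realLpNorm_le_rpow_mul_rpow hr₀ hrs hs hf hfr
  have hpow (θ : ℝ) (hθ : 0 < 1 - θ) := rpow_le_of_le_rpow_mul_rpow hp (realLpNorm_nonneg 2 f)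
    (realLpNorm_nonneg s f) (sub_pos.1 hθ) hinterp
  have hpow₂ := hpow _ hθ₂
  rw [div_self hθ₂.ne', sub_self, Real.rpow_zero, Real.rpow_one, mul_one] at hpow₂
  refine (min_le_min (hpow _ hθ₁) hpow₂).trans ?_
  refine min_rpow_mul_rpow_le ha hγ₀ ?_ hK (sq_nonneg _) ENNReal.toReal_nonneg fun ε hε =>
    realLpNorm_two_sq_le hJ hint hl hm hγ₀ hγ₂ hr hr₂.le hf hfr hE hε
  rw [one_sub_theta₂_div_one_sub_theta₁ hN hγ₀ hr₀ hrs hs]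
  rw [mul_add, mul_one, mul_div_cancel₀ _ ha.ne']

theorem mainTheorem3_general (N : ℕ) (hN : 1 ≤ N) (γ r s : ℝ) (hγ₀ : 0 < γ) (hγ₂ : γ ≤ 2)
    (hr : 1 ≤ r) (hrs : r < s) (hs : s ≤ 2) :
    ∃ C : ℝ → ℝ → ℝ, (∀ κ μ : ℝ, 0 < κ → 0 < μ → 0 < C κ μ) ∧
      ∀ J : EuclideanSpace ℝ (Fin N) → ℝ, (∀ z, 0 ≤ J z) →
      (∃ δ > 0, ∀ z, z ≠ 0 → ‖z‖ < δ → 0 < J z) →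
      Integrable (fun z => J z * min (‖z‖ ^ 2) 1) volume →
      ∀ κ : ℝ, 0 < κ →
        (∀ ξ : EuclideanSpace ℝ (Fin N), ‖ξ‖ ≤ 1 → κ * ‖ξ‖ ^ γ ≤ multiplier J ξ) →
        0 < multiplierInf J ∧
        ∀ z : EuclideanSpace ℝ (Fin N) → ℝ, MemLp z 2 volume → MemLp z (ENNReal.ofReal r) volume →
          ENNReal.ofReal (C κ (multiplierInf J) *
            min
              ((realLpNorm s z * realLpNorm r z ^ (-theta₁ N γ r s)) ^ (2 / (1 - theta₁ N γ r s)))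
              ((realLpNorm s z * realLpNorm r z ^ (-theta₂ r s)) ^ (2 / (1 - theta₂ r s))))
            ≤ dirichletForm J z := by
  have hK {l : ℝ} (hl : 0 < l) : 0 < 2 * nashConstant N r l :=
    mul_pos two_pos (one_pos.trans_le (one_le_nashConstant N r hl))
  refine ⟨fun κ μ => ((2 * nashConstant N r (min κ μ)) ^
    ((1 - theta₂ r s) / (1 - theta₁ N γ r s)))⁻¹,
    fun κ μ hκ hμ => inv_pos.2 (Real.rpow_pos_of_pos (hK (lt_min hκ hμ)) _), ?_⟩
  intro J hJ hpos hint κ hκ hm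
  have hμ : 0 < multiplierInf J := multiplierInf_pos hN hJ hpos hint
  refine ⟨hμ, fun z hz hzr => ?_⟩
  obtain hE | hE := eq_or_ne (dirichletForm J z) ∞
  · exact hE ▸ le_top
  have hl : 0 < min κ (multiplierInf J) := lt_min hκ hμ
  refine ENNReal.ofReal_le_of_le_toReal ((inv_mul_le_iff₀ (Real.rpow_pos_of_pos (hK hl) _)).2 ?_)
  exact min_rpow_realLpNorm_le hN hJ hint hl (min_mul_min_rpow_le_multiplier hJ hκ.le hm)
    hγ₀.le hγ₂ hr hrs hs hz hzr hE

/-- The constant is `C κ μ`, where `C` depends only on `N, γ, r, s`, where `κ` is the constant in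
the lower bound of the multiplier on `|ξ| ≤ 1`, and `μ > 0` is its infimum on `|ξ| ≥ 1`. -/
theorem mainTheorem3 (N : ℕ) (hN : 1 ≤ N) (γ r s : ℝ) (hγ₀ : 0 < γ) (hγ₂ : γ ≤ 2)
    (hr : 1 < r) (hrs : r < s) (hs : s ≤ 2) :
    ∃ C : ℝ → ℝ → ℝ, (∀ κ μ : ℝ, 0 < κ → 0 < μ → 0 < C κ μ) ∧
      ∀ J : EuclideanSpace ℝ (Fin N) → ℝ, IsLevyKernel J →
      ∀ κ : ℝ, 0 < κ →
        (∀ ξ : EuclideanSpace ℝ (Fin N), ‖ξ‖ ≤ 1 → κ * ‖ξ‖ ^ γ ≤ multiplier J ξ) →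
        0 < multiplierInf J ∧
        ∀ z : EuclideanSpace ℝ (Fin N) → ℝ,
          MemEnergySpace J z → MemLp z (ENNReal.ofReal r) volume →
          ENNReal.ofReal (C κ (multiplierInf J) *
            min
              ((realLpNorm s z * realLpNorm r z ^ (-theta₁ N γ r s)) ^ (2 / (1 - theta₁ N γ r s)))
              ((realLpNorm s z * realLpNorm r z ^ (-theta₂ r s)) ^ (2 / (1 - theta₂ r s))))
            ≤ dirichletForm J z := by
  obtain ⟨C, hC, hbound⟩ := mainTheorem3_general N hN γ r s hγ₀ hγ₂ hr.le hrs hs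
  refine ⟨C, hC, fun J hJ κ hκ hm => ?_⟩
  obtain ⟨hμ, hz⟩ := hbound J hJ.nonneg hJ.pos_near_zero hJ.integrable κ hκ hm
  exact ⟨hμ, fun z hz₂ hzr => hz z hz₂.1 hzr⟩
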